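/- Fix a lead time $L\ge 0$ (an integer), a holding cost $h\ge 0$ and a lost-sales penalty $p\ge 0$ per unit, and let the demands $d_1,d_2,\dots$ be i.i.d. nonnegative random variables with distribution $F$. For $x\ge 0$ let $\mathcal S^x$ be the set of vectors $\mathbf s=(s(0),\dots,s(L))$ with nonnegative entries that sum to $x$; here $s(0)$ is the on-hand inventory and $s(1),\dots,s(L)$ are the outstanding orders, oldest first. The base-stock policy with level $x$, started in $\mathbf s_1\in\mathcal S^x$, generates the states $$\mathbf s_{t+1}=(s_t(0)-y_t+s_t(1),\,s_t(2),\dots,s_t(L),\,y_t),\qquad y_t=\min\{s_t(0),d_t\},\qquad t\ge 1$$ (for $L=0$ the state is constantly equal to $(x)$). The cost of a state is the expected pseudo-cost $C^x(\mathbf s)=\mathbb E_{d\sim F}\big[h\,(s(0)-y)-p\,y\big]$ with $y=\min\{s(0),d\}$, and the infinite-horizon average pseudo-cost from $\mathbf s\in\mathcal S^x$ is $$g^x(\mathbf s)=\mathbb E\Big[\lim_{T\to\infty}\frac1T\sum_{t=1}^T C^x(\mathbf s_t)\,\Big|\,\mathbf s_1=\mathbf s\Big].$$ Suppose that $F(0)>0$,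 i.e. that the demand is $0$ with positive probability. Then for every $x\ge 0$ and every $\mathbf s\in\mathcal S^x$ the limit exists almost surely and is integrable; the value $g^x(\mathbf s)=:g^x$ is the same for all $\mathbf s\in\mathcal S^x$; and $x\mapsto g^x$ is convex on $[0,\infty)$. -/

import Mathlib

open MeasureTheory ProbabilityTheory Filter Topology Set

namespace LostSales

/-- The set `𝒮ˣ` of states: nonnegative vectors `(s 0, …, s L)` with entries summing to `x`.
Here `s 0` is the on-hand inventory and `s 1, …, s L` are the outstanding orders, oldest first. -/
def stateSpace (L : ℕ) (x : ℝ) : Set (Fin (L + 1) → ℝ) :=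
  {s | (∀ i, 0 ≤ s i) ∧ ∑ i, s i = x}

/-- Sales in a period: the minimum of on-hand inventory and demand. -/
noncomputable def sales {L : ℕ} (s : Fin (L + 1) → ℝ) (δ : ℝ) : ℝ :=
  min (s 0) δ

/-- The state after a period with demand `δ` under the base-stock policy. With `y` the sales, it is
`(s 0 - y + s 1, s 2, …, s L, y)`: the quantity sold is reordered and the oldest order arrives.
(For lead time `L = 0` the reordered quantity arrives at once and the state is unchanged.) -/
noncomputable def step {L : ℕ} (s : Fin (L + 1) → ℝ) (δ : ℝ) : Fin (L + 1) → ℝ :=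
  (Fin.snoc (α := fun _ => ℝ) (Fin.tail s) (sales s δ) : Fin (L + 1) → ℝ)
    + Pi.single 0 (s 0 - sales s δ)

/-- The state process started from `s`, driven by the demands `d 0, d 1, …`
(time is counted from `0`, so `states d s 0 ω = s`). -/
noncomputable def states {Ω : Type*} {L : ℕ} (d : ℕ → Ω → ℝ) (s : Fin (L + 1) → ℝ) :
    ℕ → Ω → Fin (L + 1) → ℝ
  | 0, _ => s
  | t + 1, ω => step (states d s t ω) (d t ω)

/-- The pseudo-cost of a period with state `s` and demand `δ`: holding cost on the leftover
inventory minus `p` times the sales. -/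
noncomputable def pseudoCost {L : ℕ} (h p : ℝ) (s : Fin (L + 1) → ℝ) (δ : ℝ) : ℝ :=
  h * (s 0 - sales s δ) - p * sales s δ

/-- The cost of a state: expected pseudo-cost of a period, given its state `s`, when the demand of
the period has distribution `F`. -/
noncomputable def stateCost {L : ℕ} (h p : ℝ) (F : Measure ℝ) (s : Fin (L + 1) → ℝ) : ℝ :=
  ∫ δ, pseudoCost h p s δ ∂F

/-- Average state cost over the first `T` periods, along the sample path `ω`, from the state `s`. -/
noncomputable def avgCost {Ω : Type*} {L : ℕ} (h p : ℝ) (F : Measure ℝ) (d : ℕ → Ω → ℝ)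
    (s : Fin (L + 1) → ℝ) (T : ℕ) (ω : Ω) : ℝ :=
  (1 / (T : ℝ)) * ∑ t ∈ Finset.range T, stateCost h p F (states d s t ω)

/-- The limit, as `T → ∞`, of the average cost along the sample path `ω`. -/
noncomputable def limitCost {Ω : Type*} {L : ℕ} (h p : ℝ) (F : Measure ℝ) (d : ℕ → Ω → ℝ)
    (s : Fin (L + 1) → ℝ) (ω : Ω) : ℝ :=
  limUnder atTop (fun T : ℕ => avgCost h p F d s T ω)

/-- The loss `gˣ(s)`: expected infinite-horizon average pseudo-cost from the starting state `s`
(the base-stock level `x` is the sum of the entries of `s`). -/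
noncomputable def loss {Ω : Type*} [MeasurableSpace Ω] {L : ℕ} (h p : ℝ) (F : Measure ℝ)
    (P : Measure Ω) (d : ℕ → Ω → ℝ) (s : Fin (L + 1) → ℝ) : ℝ :=
  ∫ ω, limitCost h p F d s ω ∂P

end LostSales

/-!
The proof rests on three facts about the base-stock policy.

**Pathwise convexity.** Start with `x` units on hand and none on order, fix the demands, and let
`Y t` be the total sales of the first `t` periods. The pipeline holds exactly the sales of the last
`L` periods, so `Y (t + 1) = min (x + Y (t - L)) (Y t + d t)` with `Y = 0` before period `0`
(`totalSales_succ_eq_min`). Hence `Y t` is concave in `x`. The leftover inventory of period `j` is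
`x - Y (j + 1) + Y (j - L)`, which telescopes, so the pseudo-cost of the first `m` periods is
`h * (m * x - ∑ i ≤ L, Y (m - i)) - p * Y m`, a convex function of `x` already for finite `m`
(`convexOn_sum_pseudoCost`).

**Coupling.** After `L` consecutive periods without demand the pipeline is empty and all of the `x`
units are on hand, whatever the initial state (`path_eq_onHand_of_zero_demand`). From then on the
paths from different states coincide. As `F {0} > 0`, this happens almost surely.

**Block averages.** Cut time into blocks of `m` periods, and compare the process with the one that
is restarted at the beginning of each block from the state with everything on hand. The restarted
block costs are i.i.d. and obey the strong law. The two processes differ within a block only before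
its first run of `L` zero demands, and the expected share of a block spent in this way tends to `0`
as `m → ∞`. So the average cost converges almost surely, and its limit is the limit of the expected
average block costs (`exists_tendsto_avgCost`), in which the starting state does not occur. Since
the state of a period is independent of its demand, the expected block cost is the expected
pseudo-cost of `m` periods (`integral_blockCost_eq`), which is convex in `x`. The loss is a
pointwise limit of these convex functions.
-/

namespace LostSales

variable {L : ℕ}

/-! ### The dynamics along a demand sequence -/

/-- The state in period `t`, started from `s`, along the demand sequence `e`. -/
noncomputable def path (e : ℕ → ℝ) (s : Fin (L + 1) → ℝ) : ℕ → Fin (L + 1) → ℝ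
  | 0 => s
  | t + 1 => step (path e s t) (e t)

/-- The state with all of the base-stock level on hand and nothing on order. -/
noncomputable def onHand (L : ℕ) (x : ℝ) : Fin (L + 1) → ℝ := Pi.single 0 x

lemma states_eq_path {Ω : Type*} (d : ℕ → Ω → ℝ) (s : Fin (L + 1) → ℝ) (t : ℕ) (ω : Ω) :
    states d s t ω = path (fun i => d i ω) s t := by
  induction t with
  | zero => rfl
  | succ t ih => simp [states, path, ih]

lemma step_apply (s : Fin (L + 1) → ℝ) (δ : ℝ) (i : Fin (L + 1)) :
    step s δ i = (if hi : i.val < L then s ⟨i.val + 1, by omega⟩ else sales s δ)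
      + (if i = 0 then s 0 - sales s δ else 0) := by
  simp only [step, Pi.add_apply, Pi.single_apply, Fin.snoc, Fin.tail]
  congr 1

lemma path_add (e : ℕ → ℝ) (s : Fin (L + 1) → ℝ) (k j : ℕ) :
    path e s (k + j) = path (fun i => e (k + i)) (path e s k) j := by
  induction j with
  | zero => rfl
  | succ j ih => rw [← add_assoc, path, path, ih]

lemma path_congr {e e' : ℕ → ℝ} (s : Fin (L + 1) → ℝ) {t : ℕ} (h : ∀ i < t, e i = e' i) :
    path e s t = path e' s t := by
  induction t with
  | zero => rfl
  | succ t ih =>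
    rw [path, path, ih fun i hi => h i (by omega), h t (by omega)]

lemma sum_step (s : Fin (L + 1) → ℝ) (δ : ℝ) : ∑ i, step s δ i = ∑ i, s i := by
  simp only [step, Pi.add_apply, Finset.sum_add_distrib, Fin.sum_snoc, Finset.sum_pi_single',
    Finset.mem_univ, if_true]
  rw [Fin.sum_univ_succ s]
  simp only [Fin.tail]
  ring

lemma step_mem {x : ℝ} {s : Fin (L + 1) → ℝ} (hs : s ∈ stateSpace L x) {δ : ℝ} (hδ : 0 ≤ δ) :
    step s δ ∈ stateSpace L x := by
  refine ⟨fun i => ?_, (sum_step s δ).trans hs.2⟩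
  have h1 : 0 ≤ sales s δ := le_min (hs.1 0) hδ
  have h2 : sales s δ ≤ s 0 := min_le_left _ _
  rw [step_apply]
  have h3 : ∀ j, 0 ≤ s j := hs.1
  split_ifs <;> first | linarith | (have := h3 ⟨i.val + 1, by omega⟩; linarith)

lemma path_mem {x : ℝ} {s : Fin (L + 1) → ℝ} (hs : s ∈ stateSpace L x) {e : ℕ → ℝ}
    (he : ∀ i, 0 ≤ e i) (t : ℕ) : path e s t ∈ stateSpace L x := by
  induction t with
  | zero => exact hs
  | succ t ih => exact step_mem ih (he t)

lemma onHand_mem {x : ℝ} (hx : 0 ≤ x) : onHand L x ∈ stateSpace L x := by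
  refine ⟨fun i => ?_, by simp [onHand]⟩
  rw [onHand, Pi.single_apply]
  split_ifs <;> simp [hx]

/-! ### Coupling by zero demands -/

/-- After `j` periods without demand, the last `j` orders are empty. -/
lemma path_eq_zero_of_zero_demand {x : ℝ} {s : Fin (L + 1) → ℝ} (hs : s ∈ stateSpace L x)
    {e : ℕ → ℝ} {j : ℕ} (he : ∀ i < j, e i = 0) :
    path e s j ∈ stateSpace L x ∧
      ∀ i : Fin (L + 1), i ≠ 0 → L < i.val + j → path e s j i = 0 := by
  induction j with
  | zero => exact ⟨hs, fun i _ hi => absurd i.isLt (by omega)⟩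
  | succ j ih =>
    obtain ⟨hmem, hz⟩ := ih fun i hi => he i (by omega)
    have he0 : e j = 0 := he j (by omega)
    refine ⟨by rw [path, he0]; exact step_mem hmem le_rfl, fun i hi hij => ?_⟩
    have hsales : sales (path e s j) (e j) = 0 := by
      rw [sales, he0]; exact min_eq_right (hmem.1 0)
    rw [path, step_apply, hsales, if_neg hi, add_zero]
    split_ifs with hiL
    · exact hz _ (fun h => by simpa using congrArg Fin.val h) (by simp only; omega)
    · rfl

/-- A lead time without demand empties the pipeline, whatever the initial state. -/
lemma path_eq_onHand_of_zero_demand {x : ℝ} {s : Fin (L + 1) → ℝ} (hs : s ∈ stateSpace L x)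
    {e : ℕ → ℝ} (he : ∀ i < L, e i = 0) : path e s L = onHand L x := by
  obtain ⟨hmem, hz⟩ := path_eq_zero_of_zero_demand hs he
  have hz' : ∀ i : Fin (L + 1), i ≠ 0 → path e s L i = 0 := fun i hi =>
    hz i hi (by have := Fin.pos_iff_ne_zero.2 hi; rw [Fin.lt_def] at this; simp at this; omega)
  have h0 : path e s L 0 = x := by
    rw [← hmem.2, Finset.sum_eq_single 0 (fun i _ hi => hz' i hi) (by simp)]
  ext i
  rw [onHand, Pi.single_apply]
  split_ifs with hi
  · rw [hi, h0]
  · exact hz' i hi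

/-- Among the first `j` demands there are `L` consecutive zeros. -/
def HasZeroRun (L : ℕ) (e : ℕ → ℝ) (j : ℕ) : Prop :=
  ∃ i, i + L ≤ j ∧ ∀ l < L, e (i + l) = 0

/-- Coupling: after a run of `L` zero demands, the paths from any two states of the same base-stock
level coincide. -/
lemma HasZeroRun.path_eq {e : ℕ → ℝ} {j : ℕ} (hj : HasZeroRun L e j) (he : ∀ i, 0 ≤ e i) {x : ℝ}
    {s s' : Fin (L + 1) → ℝ} (hs : s ∈ stateSpace L x) (hs' : s' ∈ stateSpace L x) :
    path e s j = path e s' j := by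
  obtain ⟨i, hij, hi⟩ := hj
  have key : ∀ r : Fin (L + 1) → ℝ, r ∈ stateSpace L x → path e r (i + L) = onHand L x :=
    fun r hr => by
      rw [path_add]
      exact path_eq_onHand_of_zero_demand (path_mem hr he i) hi
  obtain ⟨k, rfl⟩ := Nat.exists_eq_add_of_le hij
  rw [path_add, path_add e s', key s hs, key s' hs']

lemma HasZeroRun.mono {e : ℕ → ℝ} {j k : ℕ} (hj : HasZeroRun L e j) (hjk : j ≤ k) :
    HasZeroRun L e k := by
  obtain ⟨i, hij, hi⟩ := hj
  exact ⟨i, hij.trans hjk, hi⟩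

lemma hasZeroRun_congr {e e' : ℕ → ℝ} {j : ℕ} (h : ∀ i < j, e i = e' i) :
    HasZeroRun L e j ↔ HasZeroRun L e' j := by
  refine exists_congr fun i => and_congr_right fun hij => forall₂_congr fun l hl => ?_
  rw [h (i + l) (by omega)]

/-! ### Convexity of the cumulative pseudo-cost along a demand sequence -/

/-- Total sales in the first `t` periods, started with `x` units on hand and none on order. -/
noncomputable def totalSales (L : ℕ) (e : ℕ → ℝ) (x : ℝ) (t : ℕ) : ℝ :=
  ∑ j ∈ Finset.range t, sales (path e (onHand L x) j) (e j)

lemma totalSales_succ (e : ℕ → ℝ) (x : ℝ) (t : ℕ) :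
    totalSales L e x (t + 1) = totalSales L e x t + sales (path e (onHand L x) t) (e t) :=
  Finset.sum_range_succ _ _

@[simp] lemma totalSales_zero (e : ℕ → ℝ) (x : ℝ) : totalSales L e x 0 = 0 := rfl

/-- The outstanding orders are the sales of the last `L` periods. The truncated subtraction is
intended: before period `0` nothing was sold. -/
lemma path_onHand_apply (e : ℕ → ℝ) (x : ℝ) (t : ℕ) :
    path e (onHand L x) t 0 = x - totalSales L e x t + totalSales L e x (t - L) ∧
    ∀ i : Fin (L + 1), i ≠ 0 → path e (onHand L x) t i =
      totalSales L e x (t + i.val - L) - totalSales L e x (t + i.val - 1 - L) := by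
  induction t with
  | zero =>
    refine ⟨by simp [path, onHand], fun i hi => ?_⟩
    have h1 : 0 + i.val - L = 0 := by omega
    have h2 : 0 + i.val - 1 - L = 0 := by omega
    rw [h1, h2, path, onHand, Pi.single_eq_of_ne hi, sub_self]
  | succ t ih =>
    obtain ⟨ih0, ih1⟩ := ih
    have hsucc := totalSales_succ (L := L) e x t
    set y := sales (path e (onHand L x) t) (e t) with hy
    refine ⟨?_, fun i hi => ?_⟩
    · rw [path, step_apply, ← hy, if_pos rfl]
      split_ifs with hL
      · have hL' : 0 < L := hL
        rw [ih1 _ (fun h => by simpa using congrArg Fin.val h), ih0, hsucc]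
        have h1 : t + (((0 : Fin (L + 1)) : ℕ) + 1) - L = t + 1 - L := by simp
        have h2 : t + (((0 : Fin (L + 1)) : ℕ) + 1) - 1 - L = t - L := by simp
        simp only [h1, h2]
        ring
      · have hL' : L = 0 := by simpa using hL
        subst hL'
        rw [ih0]
        simp
    · have hi0 : i.val ≠ 0 := fun h => hi (Fin.ext h)
      rw [path, step_apply, ← hy, if_neg hi, add_zero]
      split_ifs with hiL
      · rw [ih1 _ (fun h => by simpa using congrArg Fin.val h)]
        have h1 : t + (i.val + 1) - L = t + 1 + i.val - L := by omega
        have h2 : t + (i.val + 1) - 1 - L = t + 1 + i.val - 1 - L := by omega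
        simp only [h1, h2]
      · have h1 : t + 1 + i.val - L = t + 1 := by omega
        have h2 : t + 1 + i.val - 1 - L = t := by omega
        rw [h1, h2, hsucc]
        ring

/-- The total sales solve a recursion that is concave and monotone in its arguments. -/
lemma totalSales_succ_eq_min (e : ℕ → ℝ) (x : ℝ) (t : ℕ) :
    totalSales L e x (t + 1) =
      min (x + totalSales L e x (t - L)) (totalSales L e x t + e t) := by
  rw [totalSales_succ, sales, (path_onHand_apply e x t).1, ← min_add_add_left]
  congr 1
  ring

lemma concaveOn_totalSales (e : ℕ → ℝ) (t : ℕ) :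
    ConcaveOn ℝ univ fun x => totalSales L e x t := by
  induction t using Nat.strong_induction_on with
  | _ t ih =>
    cases t with
    | zero => simpa using concaveOn_const (0 : ℝ) convex_univ
    | succ t =>
      simp only [totalSales_succ_eq_min]
      exact ((concaveOn_id convex_univ).add (ih (t - L) (by omega))).inf
        ((ih t (by omega)).add (concaveOn_const (e t) convex_univ))

/-- The unsold inventory telescopes: what is missing from `m * x` are the sales still on order. -/
lemma sum_pseudoCost_eq (h p : ℝ) (e : ℕ → ℝ) (x : ℝ) (m : ℕ) :
    ∑ j ∈ Finset.range m, pseudoCost h p (path e (onHand L x) j) (e j) =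
      h * (m * x - ∑ i ∈ Finset.range (L + 1), totalSales L e x (m - i))
        - p * totalSales L e x m := by
  induction m with
  | zero => simp
  | succ m ih =>
    rw [Finset.sum_range_succ, ih, Finset.sum_range_succ (fun i => totalSales L e x (m - i)),
      Finset.sum_range_succ' (fun i => totalSales L e x (m + 1 - i))]
    have hsum : ∑ k ∈ Finset.range L, totalSales L e x (m + 1 - (k + 1)) =
        ∑ k ∈ Finset.range L, totalSales L e x (m - k) :=
      Finset.sum_congr rfl fun k _ => by congr 1; omega
    have hsucc := totalSales_succ (L := L) e x m
    rw [hsum, pseudoCost, (path_onHand_apply e x m).1, Nat.sub_zero, hsucc]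
    push_cast
    ring

lemma convexOn_sum_pseudoCost {h p : ℝ} (hh : 0 ≤ h) (hp : 0 ≤ p) (e : ℕ → ℝ) (m : ℕ) :
    ConvexOn ℝ univ fun x =>
      ∑ j ∈ Finset.range m, pseudoCost h p (path e (onHand L x) j) (e j) := by
  refine ⟨convex_univ, fun x _ y _ a b ha hb hab => ?_⟩
  have hc : ∀ t, a * totalSales L e x t + b * totalSales L e y t ≤
      totalSales L e (a * x + b * y) t := fun t => by
    simpa using (concaveOn_totalSales (L := L) e t).2 (mem_univ x) (mem_univ y) ha hb hab
  have hs := Finset.sum_le_sum fun i (_ : i ∈ Finset.range (L + 1)) => hc (m - i)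
  rw [Finset.sum_add_distrib, ← Finset.mul_sum, ← Finset.mul_sum] at hs
  simp only [sum_pseudoCost_eq, smul_eq_mul]
  have h1 := mul_le_mul_of_nonneg_left hs hh
  have h2 := mul_le_mul_of_nonneg_left (hc m) hp
  linarith

/-! ### Bounds and measurability -/

lemma apply_zero_mem {x : ℝ} {s : Fin (L + 1) → ℝ} (hs : s ∈ stateSpace L x) :
    s 0 ∈ Icc 0 x :=
  ⟨hs.1 0, hs.2 ▸ Finset.single_le_sum (fun i _ => hs.1 i) (Finset.mem_univ 0)⟩

lemma abs_pseudoCost_le {h p x : ℝ} (hh : 0 ≤ h) (hp : 0 ≤ p) {s : Fin (L + 1) → ℝ}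
    (hs : s ∈ stateSpace L x) {δ : ℝ} (hδ : 0 ≤ δ) : |pseudoCost h p s δ| ≤ (h + p) * x := by
  obtain ⟨h0, hx⟩ := apply_zero_mem hs
  have h1 : 0 ≤ sales s δ := le_min h0 hδ
  have h2 : sales s δ ≤ s 0 := min_le_left _ _
  rw [pseudoCost, abs_le]
  constructor <;> nlinarith [mul_nonneg hh (sub_nonneg.2 h2), mul_nonneg hp h1,
    mul_le_mul_of_nonneg_left (h2.trans hx) hp,
    mul_le_mul_of_nonneg_left (show s 0 - sales s δ ≤ x by linarith) hh]

lemma abs_stateCost_le {h p x : ℝ} (hh : 0 ≤ h) (hp : 0 ≤ p) {F : Measure ℝ}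
    [IsProbabilityMeasure F] (hF : ∀ᵐ δ ∂F, 0 ≤ δ) {s : Fin (L + 1) → ℝ}
    (hs : s ∈ stateSpace L x) : |stateCost h p F s| ≤ (h + p) * x := by
  have := norm_integral_le_of_norm_le_const (μ := F) (f := pseudoCost h p s)
    (C := (h + p) * x) (hF.mono fun δ hδ => abs_pseudoCost_le hh hp hs hδ)
  simpa [stateCost] using this

lemma continuous_sales : Continuous fun q : (Fin (L + 1) → ℝ) × ℝ => sales q.1 q.2 := by
  unfold sales
  fun_prop

lemma continuous_pseudoCost (h p : ℝ) :
    Continuous fun q : (Fin (L + 1) → ℝ) × ℝ => pseudoCost h p q.1 q.2 := by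
  have := continuous_sales (L := L)
  unfold pseudoCost
  fun_prop

lemma continuous_step :
    Continuous fun q : (Fin (L + 1) → ℝ) × ℝ => step q.1 q.2 := by
  have hs := continuous_sales (L := L)
  refine continuous_pi fun i => ?_
  simp only [step_apply]
  split_ifs <;> fun_prop

lemma continuous_path (s : Fin (L + 1) → ℝ) (t : ℕ) :
    Continuous fun e : ℕ → ℝ => path e s t := by
  induction t with
  | zero => exact continuous_const
  | succ t ih => exact continuous_step.comp (ih.prodMk (continuous_apply t))

lemma measurable_stateCost (h p : ℝ) (F : Measure ℝ) [SFinite F] :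
    Measurable fun s : Fin (L + 1) → ℝ => stateCost h p F s := by
  have hm : StronglyMeasurable
      (Function.uncurry fun (s : Fin (L + 1) → ℝ) δ => pseudoCost h p s δ) :=
    (continuous_pseudoCost h p).measurable.stronglyMeasurable
  exact (hm.integral_prod_right (ν := F)).measurable

lemma measurableSet_hasZeroRun (L j : ℕ) : MeasurableSet {e : ℕ → ℝ | HasZeroRun L e j} := by
  have : {e : ℕ → ℝ | HasZeroRun L e j} =
      ⋃ (i : ℕ) (_ : i + L ≤ j), ⋂ (l : ℕ) (_ : l < L), (fun e : ℕ → ℝ => e (i + l)) ⁻¹' {0} := by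
    ext e
    simp [HasZeroRun]
  rw [this]
  exact MeasurableSet.iUnion fun i => MeasurableSet.iUnion fun _ => MeasurableSet.iInter fun l =>
    MeasurableSet.iInter fun _ => measurable_pi_apply (i + l) (measurableSet_singleton 0)

/-! ### A strong law for functionals of blocks -/

section Blocks

variable {Ω : Type*} [MeasurableSpace Ω] {P : Measure Ω} {d : ℕ → Ω → ℝ}

/-- Functionals of disjoint finite sets of coordinates of an independent sequence are
independent. -/
lemma indepFun_of_dependsOn (hd_indep : iIndepFun d P) (hd_meas : ∀ t, Measurable (d t))
    {β γ : Type*} [MeasurableSpace β] [MeasurableSpace γ] {Φ : (ℕ → ℝ) → β} {Ψ : (ℕ → ℝ) → γ}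
    (hΦ : Measurable Φ) (hΨ : Measurable Ψ) {S T : Finset ℕ} (hΦS : DependsOn Φ (S : Set ℕ))
    (hΨT : DependsOn Ψ (T : Set ℕ)) (hST : Disjoint S T) :
    IndepFun (fun ω => Φ fun i => d i ω) (fun ω => Ψ fun i => d i ω) P := by
  have hext : ∀ U : Finset ℕ,
      Measurable fun (v : U → ℝ) (i : ℕ) => if hi : i ∈ U then v ⟨i, hi⟩ else 0 := fun U =>
    measurable_pi_lambda _ fun i => by split_ifs <;> fun_prop
  have h := (hd_indep.indepFun_finset S T hST hd_meas).comp
    (hΦ.comp (hext S)) (hΨ.comp (hext T))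
  have eΦ : (Φ ∘ fun (v : S → ℝ) (i : ℕ) => if hi : i ∈ S then v ⟨i, hi⟩ else 0) ∘
      (fun ω (i : S) => d i ω) = fun ω => Φ fun i => d i ω :=
    funext fun ω => hΦS fun i hi => by simp [Finset.mem_coe.1 hi]
  have eΨ : (Ψ ∘ fun (v : T → ℝ) (i : ℕ) => if hi : i ∈ T then v ⟨i, hi⟩ else 0) ∘
      (fun ω (i : T) => d i ω) = fun ω => Ψ fun i => d i ω :=
    funext fun ω => hΨT fun i hi => by simp [Finset.mem_coe.1 hi]
  rwa [eΦ, eΨ] at h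

variable [IsProbabilityMeasure P] {F : Measure ℝ}

lemma map_block_eq_pi (hd_meas : ∀ t, Measurable (d t)) (hd_law : ∀ t, P.map (d t) = F)
    (hd_indep : iIndepFun d P) (m a : ℕ) :
    P.map (fun ω (i : Fin m) => d (a + i) ω) = Measure.pi fun _ => F := by
  have hinj : Function.Injective fun i : Fin m => a + (i : ℕ) := fun i j hij =>
    Fin.ext (Nat.add_left_cancel hij)
  have h := (iIndepFun_iff_map_fun_eq_pi_map fun i : Fin m =>
    (hd_meas (a + i)).aemeasurable).1 (hd_indep.precomp hinj)
  simpa only [hd_law] using h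

/-- The strong law of large numbers for a functional of consecutive blocks of `m` demands. -/
lemma strong_law_blocks (hd_meas : ∀ t, Measurable (d t)) (hd_law : ∀ t, P.map (d t) = F)
    (hd_indep : iIndepFun d P) {m : ℕ} {Φ : (ℕ → ℝ) → ℝ} (hΦ : Measurable Φ)
    (hΦm : DependsOn Φ (Set.Iio m)) (hint : Integrable (fun ω => Φ fun i => d i ω) P) :
    ∀ᵐ ω ∂P, Tendsto
      (fun n : ℕ => (∑ k ∈ Finset.range n, Φ fun i => d (k * m + i) ω) / (n : ℝ)) atTop
      (𝓝 (∫ ω, Φ (fun i => d i ω) ∂P)) := by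
  have hext : Measurable fun (v : Fin m → ℝ) (i : ℕ) => if hi : i < m then v ⟨i, hi⟩ else 0 :=
    measurable_pi_lambda _ fun i => by split_ifs <;> fun_prop
  have hfac : ∀ a : ℕ, (fun ω => Φ fun i => d (a + i) ω) =
      (Φ ∘ fun (v : Fin m → ℝ) (i : ℕ) => if hi : i < m then v ⟨i, hi⟩ else 0) ∘
        fun ω (i : Fin m) => d (a + i) ω := fun a =>
    funext fun ω => hΦm fun i hi => by simp [Set.mem_Iio.1 hi]
  have hzero : ∀ ω, (fun i => d (0 * m + i) ω) = fun i => d i ω := fun ω => by simp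
  have key := strong_law_ae_real (μ := P) (fun k ω => Φ fun i => d (k * m + i) ω)
    (by simpa only [hzero] using hint) ?_ ?_
  · simpa only [hzero] using key
  · intro j k hjk
    have hdep : ∀ a, DependsOn (fun e : ℕ → ℝ => Φ fun i => e (a * m + i))
        (Finset.Ico (a * m) (a * m + m) : Set ℕ) := fun a e e' h =>
      hΦm fun i hi => h _ (by have := Set.mem_Iio.1 hi; simp; omega)
    have hmeas : ∀ a, Measurable fun e : ℕ → ℝ => Φ fun i => e (a * m + i) := fun a =>
      hΦ.comp (measurable_pi_lambda _ fun i => measurable_pi_apply _)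
    refine indepFun_of_dependsOn hd_indep hd_meas (hmeas j) (hmeas k) (hdep j) (hdep k) ?_
    rw [Finset.disjoint_left]
    intro i hi hi'
    simp only [Finset.mem_Ico] at hi hi'
    rcases lt_or_gt_of_ne hjk with h | h
    · have := Nat.mul_le_mul_right m (Nat.succ_le_of_lt h)
      rw [Nat.succ_mul] at this
      omega
    · have := Nat.mul_le_mul_right m (Nat.succ_le_of_lt h)
      rw [Nat.succ_mul] at this
      omega
  · intro k
    simp only [hfac]
    refine IdentDistrib.comp ⟨?_, ?_, ?_⟩ (hΦ.comp hext)
    · exact (measurable_pi_lambda _ fun i => hd_meas _).aemeasurable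
    · exact (measurable_pi_lambda _ fun i => hd_meas _).aemeasurable
    · rw [map_block_eq_pi hd_meas hd_law hd_indep, map_block_eq_pi hd_meas hd_law hd_indep]

/-! ### Zero runs occur almost surely -/

open Classical in
/-- The indicator that the first `j` demands contain no run of `L` consecutive zeros. -/
noncomputable def noZeroRun (L : ℕ) (e : ℕ → ℝ) (j : ℕ) : ℝ := if HasZeroRun L e j then 0 else 1

lemma measurable_noZeroRun (L j : ℕ) : Measurable fun e : ℕ → ℝ => noZeroRun L e j :=
  Measurable.ite (measurableSet_hasZeroRun L j) measurable_const measurable_const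

lemma noZeroRun_nonneg (e : ℕ → ℝ) (j : ℕ) : 0 ≤ noZeroRun L e j := by
  unfold noZeroRun; split_ifs <;> simp

lemma noZeroRun_le_one (e : ℕ → ℝ) (j : ℕ) : noZeroRun L e j ≤ 1 := by
  unfold noZeroRun; split_ifs <;> simp

lemma integrable_noZeroRun (hd_meas : ∀ t, Measurable (d t)) (L j : ℕ) :
    Integrable (fun ω => noZeroRun L (fun i => d i ω) j) P :=
  Integrable.of_bound
    ((measurable_noZeroRun L j).comp (measurable_pi_lambda _ hd_meas)).aestronglyMeasurable 1
    (ae_of_all _ fun ω => by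
      rw [Real.norm_of_nonneg (noZeroRun_nonneg _ _)]
      exact noZeroRun_le_one _ _)

/-- A run of `L` zero demands occurs almost surely: by the strong law, a positive proportion of the
blocks of length `L` consists of zeros. -/
lemma ae_exists_hasZeroRun (hd_meas : ∀ t, Measurable (d t)) (hd_law : ∀ t, P.map (d t) = F)
    (hd_indep : iIndepFun d P) [IsProbabilityMeasure F] (hF_zero : 0 < F {0}) (L : ℕ) :
    ∀ᵐ ω ∂P, ∃ j, HasZeroRun L (fun i => d i ω) j := by
  set A : Set (ℕ → ℝ) := {e | ∀ i < L, e i = 0} with hA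
  have hAm : MeasurableSet A := by
    have : A = ⋂ (i : ℕ) (_ : i < L), (fun e : ℕ → ℝ => e i) ⁻¹' {0} := by ext e; simp [hA]
    rw [this]
    exact MeasurableSet.iInter fun i => MeasurableSet.iInter fun _ =>
      measurable_pi_apply i (measurableSet_singleton 0)
  have hdm : Measurable fun ω (i : ℕ) => d i ω := measurable_pi_lambda _ hd_meas
  have hdep : DependsOn (A.indicator (1 : (ℕ → ℝ) → ℝ)) (Set.Iio L) := fun e e' h => by
    have : e ∈ A ↔ e' ∈ A := forall₂_congr fun i hi => by rw [h i hi]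
    simp [Set.indicator_apply, this]
  have hcomp : (fun ω => A.indicator (1 : (ℕ → ℝ) → ℝ) fun i => d i ω) =
      ((fun ω (i : ℕ) => d i ω) ⁻¹' A).indicator 1 := rfl
  have hpos : 0 < ∫ ω, A.indicator (1 : (ℕ → ℝ) → ℝ) (fun i => d i ω) ∂P := by
    rw [hcomp, integral_indicator_one (hdm hAm), measureReal_def]
    refine ENNReal.toReal_pos ?_ (measure_ne_top _ _)
    have hpre : (fun ω (i : ℕ) => d i ω) ⁻¹' A =
        (fun ω (i : Fin L) => d (0 + i) ω) ⁻¹' {fun _ => 0} := by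
      ext ω
      simp [hA, funext_iff, Fin.forall_iff]
    rw [hpre, ← Measure.map_apply (measurable_pi_lambda _ fun i => hd_meas _)
      (measurableSet_singleton _), map_block_eq_pi hd_meas hd_law hd_indep,
      Measure.pi_singleton]
    exact Finset.prod_ne_zero_iff.2 fun _ _ => hF_zero.ne'
  have hint : Integrable (fun ω => A.indicator (1 : (ℕ → ℝ) → ℝ) fun i => d i ω) P := by
    rw [hcomp]
    exact (integrable_const (1 : ℝ)).indicator (hdm hAm)
  filter_upwards [strong_law_blocks hd_meas hd_law hd_indep
    (measurable_one.indicator hAm) hdep hint] with ω hω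
  by_contra! hno
  -- Without any zero run all block averages vanish, although their limit is positive.
  have hz : ∀ k, A.indicator (1 : (ℕ → ℝ) → ℝ) (fun i => d (k * L + i) ω) = 0 := fun k =>
    Set.indicator_of_notMem
      (fun hk : ∀ i < L, d (k * L + i) ω = 0 => hno (k * L + L) ⟨k * L, le_rfl, hk⟩) _
  simp only [hz, Finset.sum_const_zero, zero_div] at hω
  exact hpos.ne (tendsto_nhds_unique tendsto_const_nhds hω)

lemma tendsto_integral_noZeroRun (hd_meas : ∀ t, Measurable (d t))
    (hd_law : ∀ t, P.map (d t) = F) (hd_indep : iIndepFun d P) [IsProbabilityMeasure F]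
    (hF_zero : 0 < F {0}) (L : ℕ) :
    Tendsto (fun j => ∫ ω, noZeroRun L (fun i => d i ω) j ∂P) atTop (𝓝 0) := by
  have hdm : Measurable fun ω (i : ℕ) => d i ω := measurable_pi_lambda _ hd_meas
  rw [← integral_zero Ω ℝ (μ := P)]
  refine tendsto_integral_of_dominated_convergence (fun _ => 1)
    (fun j => ((measurable_noZeroRun L j).comp hdm).aestronglyMeasurable) (integrable_const 1)
    (fun j => ae_of_all _ fun ω => ?_) ?_
  · rw [Real.norm_of_nonneg (noZeroRun_nonneg _ _)]
    exact noZeroRun_le_one _ _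
  · filter_upwards [ae_exists_hasZeroRun hd_meas hd_law hd_indep hF_zero L] with ω ⟨j, hj⟩
    refine tendsto_const_nhds.congr' ?_
    filter_upwards [eventually_ge_atTop j] with k hk
    simp [noZeroRun, hj.mono hk]

end Blocks

/-! ### Comparison with the process restarted in every block -/

section Averages

lemma tendsto_natCast_div_div_atTop {m : ℕ} (hm : 0 < m) :
    Tendsto (fun T : ℕ => ((T / m : ℕ) : ℝ) / (T : ℝ)) atTop (𝓝 (1 / (m : ℝ))) := by
  have h := (tendsto_nat_floor_mul_div_atTop (R := ℝ) (a := 1 / (m : ℝ)) (by positivity)).comp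
    tendsto_natCast_atTop_atTop
  refine h.congr fun T => ?_
  simp only [Function.comp]
  rw [one_div_mul_eq_div, Nat.floor_div_eq_div]

lemma tendsto_comp_div_div {m : ℕ} (hm : 0 < m) {A : ℕ → ℝ} {α : ℝ}
    (hA : Tendsto (fun n : ℕ => A n / (n : ℝ)) atTop (𝓝 α)) :
    Tendsto (fun T : ℕ => A (T / m) / (T : ℝ)) atTop (𝓝 (α / m)) := by
  have h := (hA.comp (Nat.tendsto_div_const_atTop hm.ne')).mul (tendsto_natCast_div_div_atTop hm)
  rw [mul_one_div] at h
  refine h.congr' ?_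
  filter_upwards [eventually_ge_atTop m] with T hT
  have : ((T / m : ℕ) : ℝ) ≠ 0 := by exact_mod_cast (Nat.div_pos hT hm).ne'
  exact div_mul_div_cancel₀ this

/-- If `S T` is within `C + K * N (T / m)` of the sum `A (T / m)` over the complete blocks of length
`m`, then the averages of `S` are eventually close to the average of `A` per period. -/
lemma eventually_abs_div_sub_le {m : ℕ} (hm : 0 < m) {S A N : ℕ → ℝ} {C K α ν δ : ℝ}
    (hA : Tendsto (fun n : ℕ => A n / (n : ℝ)) atTop (𝓝 α))
    (hN : Tendsto (fun n : ℕ => N n / (n : ℝ)) atTop (𝓝 ν))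
    (hS : ∀ T, |S T - A (T / m)| ≤ C + K * N (T / m)) (hδ : 0 < δ) :
    ∀ᶠ T : ℕ in atTop, |S T / T - α / m| ≤ K * (ν / m) + δ := by
  have h1 := tendsto_comp_div_div hm hA
  have h2 := (tendsto_comp_div_div hm hN).const_mul K
  have h3 : Tendsto (fun T : ℕ => C / (T : ℝ)) atTop (𝓝 0) :=
    tendsto_const_nhds.div_atTop tendsto_natCast_atTop_atTop
  have h4 := (h3.add h2).add (h1.sub_const (α / m)).abs
  simp only [sub_self, abs_zero, add_zero, zero_add] at h4
  filter_upwards [h4.eventually (gt_mem_nhds (lt_add_of_pos_right _ hδ)),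
    eventually_gt_atTop 0] with T hT hT0
  have hT0' : (0 : ℝ) < T := by exact_mod_cast hT0
  have h5 : |S T / T - A (T / m) / T| ≤ C / T + K * (N (T / m) / T) := by
    rw [← sub_div, abs_div, abs_of_pos hT0']
    calc _ ≤ (C + K * N (T / m)) / T := by gcongr; exact hS T
      _ = _ := by ring
  have h6 := abs_sub_le (S T / T) (A (T / m) / T) (α / m)
  linarith

/-- A sequence that is eventually within `η m` of `a m`, with `η m → 0`, converges together
with `a`. -/
lemma exists_tendsto_of_eventually_abs_sub_le {u a η : ℕ → ℝ} (hη : Tendsto η atTop (𝓝 0))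
    (h : ∀ m, 0 < m → ∀ᶠ T in atTop, |u T - a m| ≤ η m) :
    ∃ l, Tendsto u atTop (𝓝 l) ∧ Tendsto a atTop (𝓝 l) := by
  have hc : CauchySeq u := by
    refine Metric.cauchySeq_iff.2 fun ε hε => ?_
    obtain ⟨m, hm, hm0⟩ := ((hη.eventually (gt_mem_nhds (half_pos hε))).and
      (eventually_gt_atTop 0)).exists
    obtain ⟨N, hN⟩ := eventually_atTop.1 (h m hm0)
    refine ⟨N, fun i hi j hj => ?_⟩
    have h1 := hN i hi
    have h2 := hN j hj
    rw [Real.dist_eq]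
    have h3 := abs_sub_le (u i) (a m) (u j)
    rw [abs_sub_comm (a m)] at h3
    linarith
  obtain ⟨l, hl⟩ := cauchySeq_tendsto_of_complete hc
  refine ⟨l, hl, ?_⟩
  refine tendsto_iff_dist_tendsto_zero.2 (squeeze_zero' (.of_forall fun _ => dist_nonneg) ?_ hη)
  filter_upwards [eventually_gt_atTop 0] with m hm
  rw [dist_comm, Real.dist_eq]
  exact le_of_tendsto (hl.sub_const (a m)).abs (h m hm)

/-- The cost of the first `m` periods, started with everything on hand. -/
noncomputable def blockCost (L : ℕ) (h p : ℝ) (F : Measure ℝ) (x : ℝ) (m : ℕ) (e : ℕ → ℝ) : ℝ :=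
  ∑ j ∈ Finset.range m, stateCost h p F (path e (onHand L x) j)

/-- The number of times `j < m` at which the first `j` demands contain no run of `L` zeros. -/
noncomputable def blockNoZeroRun (L m : ℕ) (e : ℕ → ℝ) : ℝ :=
  ∑ j ∈ Finset.range m, noZeroRun L e j

variable {h p x : ℝ} {F : Measure ℝ} [IsProbabilityMeasure F]

/-- Within a block, the costs from `s` and from the state with everything on hand differ only
before the first run of `L` zero demands, and there each is at most `(h + p) * x` in absolute value. -/
lemma abs_sub_blockCost_le (hh : 0 ≤ h) (hp : 0 ≤ p) (hF : ∀ᵐ δ ∂F, 0 ≤ δ) (hx : 0 ≤ x)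
    {s : Fin (L + 1) → ℝ} (hs : s ∈ stateSpace L x) {e : ℕ → ℝ} (he : ∀ i, 0 ≤ e i) (m : ℕ) :
    |(∑ j ∈ Finset.range m, stateCost h p F (path e s j)) - blockCost L h p F x m e| ≤
      2 * ((h + p) * x) * blockNoZeroRun L m e := by
  rw [blockCost, blockNoZeroRun, ← Finset.sum_sub_distrib, Finset.mul_sum]
  refine (Finset.abs_sum_le_sum_abs _ _).trans (Finset.sum_le_sum fun j _ => ?_)
  by_cases hj : HasZeroRun L e j
  · simp [hj.path_eq he hs (onHand_mem hx), noZeroRun, hj]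
  · have h1 := abs_stateCost_le hh hp hF (path_mem hs he j)
    have h2 := abs_stateCost_le hh hp hF (path_mem (onHand_mem (L := L) hx) he j)
    have h3 := abs_sub (stateCost h p F (path e s j)) (stateCost h p F (path e (onHand L x) j))
    simp only [noZeroRun, hj, if_false]
    linarith

lemma abs_sum_sub_sum_blockCost_le (hh : 0 ≤ h) (hp : 0 ≤ p) (hF : ∀ᵐ δ ∂F, 0 ≤ δ)
    (hx : 0 ≤ x) {s : Fin (L + 1) → ℝ} (hs : s ∈ stateSpace L x) {e : ℕ → ℝ}
    (he : ∀ i, 0 ≤ e i) (m n : ℕ) :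
    |(∑ t ∈ Finset.range (n * m), stateCost h p F (path e s t)) -
        ∑ k ∈ Finset.range n, blockCost L h p F x m fun i => e (k * m + i)| ≤
      2 * ((h + p) * x) * ∑ k ∈ Finset.range n, blockNoZeroRun L m fun i => e (k * m + i) := by
  induction n with
  | zero => simp
  | succ n ih =>
    have hb := abs_sub_blockCost_le hh hp hF hx (path_mem hs he (n * m))
      (e := fun i => e (n * m + i)) (fun i => he _) m
    simp only [← path_add] at hb
    rw [Nat.succ_mul, Finset.sum_range_add, Finset.sum_range_succ, Finset.sum_range_succ, mul_add,
      add_sub_add_comm]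
    exact (abs_add_le _ _).trans (add_le_add ih hb)

/-- For a horizon `T` that is not a multiple of `m`, the incomplete last block adds at most `m`
bounded terms. -/
lemma abs_sum_sub_sum_blockCost_div_le (hh : 0 ≤ h) (hp : 0 ≤ p) (hF : ∀ᵐ δ ∂F, 0 ≤ δ)
    (hx : 0 ≤ x) {s : Fin (L + 1) → ℝ} (hs : s ∈ stateSpace L x) {e : ℕ → ℝ}
    (he : ∀ i, 0 ≤ e i) {m : ℕ} (hm : 0 < m) (T : ℕ) :
    |(∑ t ∈ Finset.range T, stateCost h p F (path e s t)) -
        ∑ k ∈ Finset.range (T / m), blockCost L h p F x m fun i => e (k * m + i)| ≤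
      m * ((h + p) * x) + 2 * ((h + p) * x) *
        ∑ k ∈ Finset.range (T / m), blockNoZeroRun L m fun i => e (k * m + i) := by
  have hB : 0 ≤ (h + p) * x := by positivity
  have hmain := abs_sum_sub_sum_blockCost_le hh hp hF hx hs he m (T / m)
  have htail : |∑ j ∈ Finset.range (T % m), stateCost h p F (path e s (T / m * m + j))| ≤
      m * ((h + p) * x) := by
    calc _ ≤ ∑ j ∈ Finset.range (T % m), (h + p) * x :=
          (Finset.abs_sum_le_sum_abs _ _).trans
            (Finset.sum_le_sum fun j _ => abs_stateCost_le hh hp hF (path_mem hs he _))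
      _ = (T % m : ℕ) * ((h + p) * x) := by simp
      _ ≤ m * ((h + p) * x) := by
          gcongr
          exact_mod_cast (Nat.mod_lt T hm).le
  conv_lhs => rw [← Nat.div_add_mod' T m, Finset.sum_range_add]
  rw [Nat.div_add_mod', add_sub_right_comm, add_comm (_ * _)]
  exact (abs_add_le _ _).trans (add_le_add hmain htail)

end Averages

/-! ### Existence of the loss and its convexity -/

lemma ae_forall_nonneg {Ω : Type*} [MeasurableSpace Ω] {P : Measure Ω} {d : ℕ → Ω → ℝ}
    {F : Measure ℝ} (hF : ∀ᵐ δ ∂F, 0 ≤ δ) (hd_meas : ∀ t, Measurable (d t))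
    (hd_law : ∀ t, P.map (d t) = F) : ∀ᵐ ω ∂P, ∀ i, 0 ≤ d i ω :=
  ae_all_iff.2 fun i => ae_of_ae_map (hd_meas i).aemeasurable (by rwa [hd_law i])

section Loss

variable {Ω : Type*} [MeasurableSpace Ω] {P : Measure Ω} [IsProbabilityMeasure P]
  {d : ℕ → Ω → ℝ} {F : Measure ℝ} [IsProbabilityMeasure F] {h p x : ℝ}

lemma integrable_stateCost (hh : 0 ≤ h) (hp : 0 ≤ p) (hF : ∀ᵐ δ ∂F, 0 ≤ δ)
    (hd_meas : ∀ t, Measurable (d t)) (hd_law : ∀ t, P.map (d t) = F)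
    {s : Fin (L + 1) → ℝ} (hs : s ∈ stateSpace L x) (t : ℕ) :
    Integrable (fun ω => stateCost h p F (path (fun i => d i ω) s t)) P := by
  have hm : Measurable fun ω => stateCost h p F (path (fun i => d i ω) s t) :=
    (measurable_stateCost h p F).comp
      ((continuous_path s t).measurable.comp (measurable_pi_lambda _ hd_meas))
  refine Integrable.of_bound hm.aestronglyMeasurable ((h + p) * x) ?_
  filter_upwards [ae_forall_nonneg hF hd_meas hd_law] with ω hω
  exact abs_stateCost_le hh hp hF (path_mem hs hω t)

lemma measurable_prodMk_path (hd_meas : ∀ t, Measurable (d t)) (s : Fin (L + 1) → ℝ) (t : ℕ) :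
    Measurable fun ω => (path (fun i => d i ω) s t, d t ω) :=
  ((continuous_path s t).measurable.comp (measurable_pi_lambda _ hd_meas)).prodMk (hd_meas t)

omit [IsProbabilityMeasure F] in
lemma integrable_pseudoCost (hh : 0 ≤ h) (hp : 0 ≤ p) (hF : ∀ᵐ δ ∂F, 0 ≤ δ)
    (hd_meas : ∀ t, Measurable (d t)) (hd_law : ∀ t, P.map (d t) = F)
    {s : Fin (L + 1) → ℝ} (hs : s ∈ stateSpace L x) (t : ℕ) :
    Integrable (fun ω => pseudoCost h p (path (fun i => d i ω) s t) (d t ω)) P := by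
  have hm := (continuous_pseudoCost (L := L) h p).measurable.comp
    (measurable_prodMk_path hd_meas s t)
  refine Integrable.of_bound hm.aestronglyMeasurable ((h + p) * x) ?_
  filter_upwards [ae_forall_nonneg hF hd_meas hd_law] with ω hω
  exact abs_pseudoCost_le hh hp (path_mem hs hω t) (hω t)

/-- The state of a period is independent of its demand, so the expected state cost is the expected
realized pseudo-cost. -/
lemma integral_stateCost_eq (hh : 0 ≤ h) (hp : 0 ≤ p) (hF : ∀ᵐ δ ∂F, 0 ≤ δ)
    (hd_meas : ∀ t, Measurable (d t)) (hd_law : ∀ t, P.map (d t) = F) (hd_indep : iIndepFun d P)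
    {s : Fin (L + 1) → ℝ} (hs : s ∈ stateSpace L x) (t : ℕ) :
    ∫ ω, stateCost h p F (path (fun i => d i ω) s t) ∂P =
      ∫ ω, pseudoCost h p (path (fun i => d i ω) s t) (d t ω) ∂P := by
  have hpath : Measurable fun ω => path (fun i => d i ω) s t :=
    (continuous_path s t).measurable.comp (measurable_pi_lambda _ hd_meas)
  have hind : IndepFun (fun ω => path (fun i => d i ω) s t) (d t) P :=
    indepFun_of_dependsOn (Φ := fun e => path e s t) (Ψ := fun e => e t)
      (S := Finset.range t) (T := {t}) hd_indep hd_meas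
      (continuous_path s t).measurable (measurable_pi_apply t)
      (fun e e' he => path_congr s fun i hi => he i (by simpa using hi))
      (fun e e' he => he t (by simp)) (by simp)
  have hlaw := (indepFun_iff_map_prod_eq_prod_map_map hpath.aemeasurable
    (hd_meas t).aemeasurable).1 hind
  rw [hd_law t] at hlaw
  have hcost := (continuous_pseudoCost (L := L) h p).measurable.aestronglyMeasurable
    (μ := (P.map fun ω => path (fun i => d i ω) s t).prod F)
  have hjoint := measurable_prodMk_path hd_meas s t
  have hint : Integrable (fun q : (Fin (L + 1) → ℝ) × ℝ => pseudoCost h p q.1 q.2)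
      ((P.map fun ω => path (fun i => d i ω) s t).prod F) := by
    rw [← hlaw] at hcost ⊢
    exact (integrable_map_measure hcost hjoint.aemeasurable).2
      (integrable_pseudoCost hh hp hF hd_meas hd_law hs t)
  calc _ = ∫ r, stateCost h p F r ∂(P.map fun ω => path (fun i => d i ω) s t) :=
        (integral_map hpath.aemeasurable (measurable_stateCost h p F).aestronglyMeasurable).symm
    _ = ∫ q, pseudoCost h p q.1 q.2 ∂((P.map fun ω => path (fun i => d i ω) s t).prod F) :=
        (integral_prod _ hint).symm
    _ = _ := by
        rw [← hlaw] at hcost ⊢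
        exact integral_map hjoint.aemeasurable hcost

lemma integral_blockCost_eq (hh : 0 ≤ h) (hp : 0 ≤ p) (hF : ∀ᵐ δ ∂F, 0 ≤ δ)
    (hd_meas : ∀ t, Measurable (d t)) (hd_law : ∀ t, P.map (d t) = F) (hd_indep : iIndepFun d P)
    (hx : 0 ≤ x) (m : ℕ) :
    ∫ ω, blockCost L h p F x m (fun i => d i ω) ∂P =
      ∫ ω, ∑ j ∈ Finset.range m,
        pseudoCost h p (path (fun i => d i ω) (onHand L x) j) (d j ω) ∂P := by
  unfold blockCost
  rw [integral_finsetSum _ fun j _ =>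
      integrable_stateCost hh hp hF hd_meas hd_law (onHand_mem hx) j,
    integral_finsetSum _ fun j _ =>
      integrable_pseudoCost hh hp hF hd_meas hd_law (onHand_mem hx) j]
  exact Finset.sum_congr rfl fun j _ =>
    integral_stateCost_eq hh hp hF hd_meas hd_law hd_indep (onHand_mem hx) j

/-- The expected block cost is convex in the base-stock level, because the realized pseudo-cost is so
along every demand sequence. -/
lemma convexOn_integral_blockCost (hh : 0 ≤ h) (hp : 0 ≤ p) (hF : ∀ᵐ δ ∂F, 0 ≤ δ)
    (hd_meas : ∀ t, Measurable (d t)) (hd_law : ∀ t, P.map (d t) = F) (hd_indep : iIndepFun d P)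
    (L m : ℕ) :
    ConvexOn ℝ (Ici 0) fun x => ∫ ω, blockCost L h p F x m (fun i => d i ω) ∂P := by
  have hint : ∀ x : ℝ, 0 ≤ x → Integrable (fun ω => ∑ j ∈ Finset.range m,
      pseudoCost h p (path (fun i => d i ω) (onHand L x) j) (d j ω)) P := fun x hx =>
    integrable_finsetSum _ fun j _ =>
      integrable_pseudoCost hh hp hF hd_meas hd_law (onHand_mem hx) j
  refine ⟨convex_Ici 0, fun x hx y hy a b ha hb hab => ?_⟩
  have hxy : 0 ≤ a • x + b • y := convex_Ici (0 : ℝ) hx hy ha hb hab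
  simp only [integral_blockCost_eq hh hp hF hd_meas hd_law hd_indep hxy,
    integral_blockCost_eq hh hp hF hd_meas hd_law hd_indep (mem_Ici.1 hx),
    integral_blockCost_eq hh hp hF hd_meas hd_law hd_indep (mem_Ici.1 hy)]
  rw [← integral_smul, ← integral_smul]
  refine (integral_mono (hint _ hxy) (((hint x hx).smul a).add ((hint y hy).smul b)) fun ω =>
    ?_).trans_eq (integral_add ((hint x hx).smul a) ((hint y hy).smul b))
  exact (convexOn_sum_pseudoCost hh hp (fun i => d i ω) m).2 (mem_univ x) (mem_univ y) ha hb hab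

/-- Almost surely, and for every block length, the average cost is eventually close to the expected
average cost of a block, up to the share of the block spent before a zero run. -/
lemma ae_eventually_abs_avgCost_sub_le (hh : 0 ≤ h) (hp : 0 ≤ p) (hF : ∀ᵐ δ ∂F, 0 ≤ δ)
    (hd_meas : ∀ t, Measurable (d t)) (hd_law : ∀ t, P.map (d t) = F) (hd_indep : iIndepFun d P)
    (hx : 0 ≤ x) {s : Fin (L + 1) → ℝ} (hs : s ∈ stateSpace L x) :
    ∀ᵐ ω ∂P, ∀ m : ℕ, 0 < m → ∀ᶠ T in atTop,
      |avgCost h p F d s T ω - (∫ ω, blockCost L h p F x m (fun i => d i ω) ∂P) / m| ≤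
        2 * ((h + p) * x) * ((∫ ω, blockNoZeroRun L m (fun i => d i ω) ∂P) / m) + 1 / m := by
  have hdm : Measurable fun ω (i : ℕ) => d i ω := measurable_pi_lambda _ hd_meas
  have hcost : ∀ m, ∀ᵐ ω ∂P, Tendsto
      (fun n : ℕ =>
        (∑ k ∈ Finset.range n, blockCost L h p F x m fun i => d (k * m + i) ω) / (n : ℝ))
      atTop (𝓝 (∫ ω, blockCost L h p F x m (fun i => d i ω) ∂P)) := fun m =>
    strong_law_blocks hd_meas hd_law hd_indep
      (Finset.measurable_sum _ fun j _ =>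
        (measurable_stateCost h p F).comp (continuous_path _ j).measurable)
      (fun e e' he => Finset.sum_congr rfl fun j hj => by
        rw [path_congr _ fun i hi => he i (hi.trans (Finset.mem_range.1 hj))])
      (integrable_finsetSum _ fun j _ =>
        integrable_stateCost hh hp hF hd_meas hd_law (onHand_mem hx) j)
  have hzero : ∀ m, ∀ᵐ ω ∂P, Tendsto
      (fun n : ℕ =>
        (∑ k ∈ Finset.range n, blockNoZeroRun L m fun i => d (k * m + i) ω) / (n : ℝ))
      atTop (𝓝 (∫ ω, blockNoZeroRun L m (fun i => d i ω) ∂P)) := fun m =>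
    strong_law_blocks hd_meas hd_law hd_indep
      (Finset.measurable_sum _ fun j _ => measurable_noZeroRun L j)
      (fun e e' he => Finset.sum_congr rfl fun j hj => by
        unfold noZeroRun
        rw [hasZeroRun_congr fun i hi => he i (hi.trans (Finset.mem_range.1 hj))])
      (integrable_finsetSum _ fun j _ => integrable_noZeroRun hd_meas L j)
  filter_upwards [ae_all_iff.2 hcost, ae_all_iff.2 hzero, ae_forall_nonneg hF hd_meas hd_law]
    with ω h1 h2 h3 m hm
  have := eventually_abs_div_sub_le hm (h1 m) (h2 m)
    (S := fun T => ∑ t ∈ Finset.range T, stateCost h p F (path (fun i => d i ω) s t))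
    (fun T => abs_sum_sub_sum_blockCost_div_le hh hp hF hx hs h3 hm T)
    (δ := 1 / m) (by positivity)
  refine this.mono fun T hT => ?_
  simpa only [avgCost, states_eq_path, one_div_mul_eq_div] using hT

/-- The average cost converges almost surely to the limit of the expected average block costs,
which does not depend on the starting state. -/
lemma exists_tendsto_avgCost (hh : 0 ≤ h) (hp : 0 ≤ p) (hF : ∀ᵐ δ ∂F, 0 ≤ δ)
    (hF_zero : 0 < F {0}) (hd_meas : ∀ t, Measurable (d t)) (hd_law : ∀ t, P.map (d t) = F)
    (hd_indep : iIndepFun d P) (hx : 0 ≤ x) {s : Fin (L + 1) → ℝ} (hs : s ∈ stateSpace L x) :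
    ∃ g : ℝ, Tendsto (fun m : ℕ => (∫ ω, blockCost L h p F x m (fun i => d i ω) ∂P) / m) atTop
        (𝓝 g) ∧
      ∀ᵐ ω ∂P, Tendsto (fun T : ℕ => avgCost h p F d s T ω) atTop (𝓝 g) := by
  have hshare : Tendsto
      (fun m : ℕ => (∫ ω, blockNoZeroRun L m (fun i => d i ω) ∂P) / (m : ℝ)) atTop (𝓝 0) := by
    refine (tendsto_integral_noZeroRun hd_meas hd_law hd_indep hF_zero L).cesaro.congr fun m => ?_
    unfold blockNoZeroRun
    rw [integral_finsetSum _ fun j _ => integrable_noZeroRun hd_meas L j, div_eq_inv_mul]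
  have hη : Tendsto (fun m : ℕ => 2 * ((h + p) * x) *
      ((∫ ω, blockNoZeroRun L m (fun i => d i ω) ∂P) / m) + 1 / (m : ℝ)) atTop (𝓝 0) := by
    simpa using (hshare.const_mul (2 * ((h + p) * x))).add tendsto_one_div_atTop_nhds_zero_nat
  have hae := (ae_eventually_abs_avgCost_sub_le hh hp hF hd_meas hd_law hd_indep hx hs).mono
    fun ω hω => exists_tendsto_of_eventually_abs_sub_le hη hω
  obtain ⟨_, g, -, hg⟩ := hae.exists
  refine ⟨g, hg, hae.mono fun ω ⟨l, hl, hal⟩ => ?_⟩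
  rwa [tendsto_nhds_unique hg hal]

end Loss

end LostSales

theorem lemma4 (L : ℕ) (h p : ℝ) (hh : 0 ≤ h) (hp : 0 ≤ p)
    (F : Measure ℝ) [IsProbabilityMeasure F]
    (hF_nonneg : F (Set.Iio 0) = 0) (hF_zero : 0 < F {0})
    {Ω : Type*} [MeasurableSpace Ω] (P : Measure Ω) [IsProbabilityMeasure P]
    (d : ℕ → Ω → ℝ) (hd_meas : ∀ t, Measurable (d t)) (hd_law : ∀ t, P.map (d t) = F)
    (hd_indep : iIndepFun d P) :
    -- the limit defining the loss exists almost surely and is integrable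
    (∀ x : ℝ, 0 ≤ x → ∀ s ∈ LostSales.stateSpace L x,
      (∀ᵐ ω ∂P, ∃ l : ℝ,
        Tendsto (fun T : ℕ => LostSales.avgCost h p F d s T ω) atTop (𝓝 l)) ∧
      Integrable (LostSales.limitCost h p F d s) P) ∧
    -- the loss is the same for every starting state with the same base-stock level
    (∀ x : ℝ, 0 ≤ x → ∀ s ∈ LostSales.stateSpace L x, ∀ s' ∈ LostSales.stateSpace L x,
      LostSales.loss h p F P d s = LostSales.loss h p F P d s') ∧
    -- the loss is convex in the base-stock level, whatever the starting states
    (∀ σ : ℝ → Fin (L + 1) → ℝ, (∀ x : ℝ, 0 ≤ x → σ x ∈ LostSales.stateSpace L x) →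
      ConvexOn ℝ (Set.Ici 0) (fun x : ℝ => LostSales.loss h p F P d (σ x))) := by
  have hF : ∀ᵐ δ ∂F, 0 ≤ δ := by
    simp only [ae_iff, not_le]
    exact hF_nonneg
  have hlim : ∀ x : ℝ, 0 ≤ x → ∀ s ∈ LostSales.stateSpace L x,
      Tendsto (fun m : ℕ => (∫ ω, LostSales.blockCost L h p F x m (fun i => d i ω) ∂P) / m) atTop
        (𝓝 (LostSales.loss h p F P d s)) ∧
      (∀ᵐ ω ∂P, ∃ l : ℝ,
        Tendsto (fun T : ℕ => LostSales.avgCost h p F d s T ω) atTop (𝓝 l)) ∧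
      Integrable (LostSales.limitCost h p F d s) P := by
    intro x hx s hs
    obtain ⟨g, hg, hae⟩ := LostSales.exists_tendsto_avgCost hh hp hF hF_zero hd_meas hd_law
      hd_indep hx hs
    have hconst : LostSales.limitCost h p F d s =ᵐ[P] fun _ => g :=
      hae.mono fun ω hω => hω.limUnder_eq
    have hloss : LostSales.loss h p F P d s = g := by
      rw [LostSales.loss, integral_congr_ae hconst]
      simp
    exact ⟨hloss ▸ hg, hae.mono fun ω hω => ⟨g, hω⟩, (integrable_const g).congr hconst.symm⟩
  refine ⟨fun x hx s hs => (hlim x hx s hs).2, fun x hx s hs s' hs' =>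
    tendsto_nhds_unique (hlim x hx s hs).1 (hlim x hx s' hs').1, fun σ hσ =>
    ⟨convex_Ici 0, fun x hx y hy a b ha hb hab => ?_⟩⟩
  have hxy : 0 ≤ a • x + b • y := convex_Ici (0 : ℝ) hx hy ha hb hab
  have hl : ∀ z : ℝ, 0 ≤ z → _ := fun z hz => (hlim z hz (σ z) (hσ z hz)).1
  -- The loss is the limit of the expected average block costs, which are convex on `[0, ∞)`.
  refine le_of_tendsto_of_tendsto' (hl _ hxy)
    (((hl x hx).const_mul a).add ((hl y hy).const_mul b)) fun m => ?_
  have hc := (LostSales.convexOn_integral_blockCost hh hp hF hd_meas hd_law hd_indep L m).2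
    hx hy ha hb hab
  rw [← mul_div_assoc, ← mul_div_assoc, ← add_div]
  exact div_le_div_of_nonneg_right hc m.cast_nonneg
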